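/- Let $d$ be a natural number and let $\Gamma\subset\mathbb{R}^d$ be a simple $C^{1,1}$ curve (for example, a planar one), that is, $\Gamma=\gamma([a,b])$ with $a<b$ and $\gamma:[a,b]\to\mathbb{R}^d$ injective and continuously differentiable, with $\gamma'$ Lipschitz and nowhere zero on $[a,b]$ (one-sided derivatives at $a$ and $b$). Let $\mathcal{H}^1$ be the one-dimensional Hausdorff measure, and for nonempty compact sets $M,\Sigma\subset\mathbb{R}^d$ let $F_M(\Sigma)=\max_{y\in M}\mathrm{dist}(y,\Sigma)$, where $\mathrm{dist}$ is the Euclidean distance. Put $l=\mathcal{H}^1(\Gamma)$ and, for $r>0$, let $M_r=\{x\in\mathbb{R}^d:\mathrm{dist}(x,\Gamma)\le r\}$ be the closed $r$-neighbourhood of $\Gamma$. Then $0<l<\infty$, and there is $r_0>0$ such that for every $r$ with $0<r<r_0$ the curve $\Gamma$ is a maximal distance minimizer for $M_r$, with energy $r$: 1. among all nonempty compact connected sets $\Sigma\subset\mathbb{R}^d$ with $\mathcal{H}^1(\Sigma)\le l$, the set $\Sigma=\Gamma$ minimizes $F_{M_r}(\Sigma)$, and $F_{M_r}(\Gamma)=r$;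 2. among all nonempty compact connected sets $\Sigma\subset\mathbb{R}^d$ with $F_{M_r}(\Sigma)\le r$, the set $\Sigma=\Gamma$ minimizes $\mathcal{H}^1(\Sigma)$. -/

import Mathlib

open Set MeasureTheory
open scoped ENNReal

/-- The energy `F_M(S) = max_{y ∈ M} dist (y, S)`, as an extended nonnegative real.
The supremum is attained when `M` and `S` are compact and nonempty;
the distance to the empty set is `∞`. -/
noncomputable def maxDistEnergy {d : ℕ} (M S : Set (EuclideanSpace ℝ (Fin d))) : ℝ≥0∞ :=
  ⨆ y ∈ M, Metric.infEDist y S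

/-- `S` is a maximal distance minimizer for the compact set `M` and the length bound `l`: among all
(nonempty) compact connected sets of one-dimensional Hausdorff measure at most `l`, the set `S`
has the smallest energy `F_M(S)`. -/
structure IsMaxDistMinimizer {d : ℕ} (M : Set (EuclideanSpace ℝ (Fin d))) (l : ℝ)
    (S : Set (EuclideanSpace ℝ (Fin d))) : Prop where
  isCompact_data : IsCompact M
  isCompact : IsCompact S
  isConnected : IsConnected S
  length_le : μH[1] S ≤ ENNReal.ofReal l
  energy_le : ∀ T : Set (EuclideanSpace ℝ (Fin d)), IsCompact T → IsConnected T →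
    μH[1] T ≤ ENNReal.ofReal l → maxDistEnergy M S ≤ maxDistEnergy M T

/-- `S` is a solution of the dual problem for the compact set `M` and the radius `r`: among all
(nonempty) compact connected sets of energy at most `r`, the set `S` has the smallest
one-dimensional Hausdorff measure. -/
structure IsDualMaxDistMinimizer {d : ℕ} (M : Set (EuclideanSpace ℝ (Fin d))) (r : ℝ)
    (S : Set (EuclideanSpace ℝ (Fin d))) : Prop where
  isCompact_data : IsCompact M
  isCompact : IsCompact S
  isConnected : IsConnected S
  energy_le : maxDistEnergy M S ≤ ENNReal.ofReal r
  length_le : ∀ T : Set (EuclideanSpace ℝ (Fin d)), IsCompact T → IsConnected T →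
    maxDistEnergy M T ≤ ENNReal.ofReal r → μH[1] S ≤ μH[1] T

/-- `Γ` is a simple `C^{1,1}` curve: the image of a compact interval under an injective, continuously
differentiable map whose derivative is Lipschitz and vanishes nowhere. The derivatives at the ends
of the interval are one-sided. -/
def IsSimpleC11Curve {d : ℕ} (Γ : Set (EuclideanSpace ℝ (Fin d))) : Prop :=
  ∃ (a b : ℝ) (γ : ℝ → EuclideanSpace ℝ (Fin d)), a < b ∧
    ContDiffOn ℝ 1 γ (Icc a b) ∧
    (∃ K, LipschitzOnWith K (derivWithin γ (Icc a b)) (Icc a b)) ∧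
    (∀ t ∈ Icc a b, derivWithin γ (Icc a b) t ≠ 0) ∧
    InjOn γ (Icc a b) ∧
    Γ = γ '' Icc a b

/-! The proof compares volumes of tubes. Let `luneRate E r`, written λ(r), be the supremum over v of
|B(v,r) \ B(0,r)| / |v|. Every compact connected T of finite length has |T_r| ≤ |B_r| + λ(r) H¹(T)
(`volume_thickening_le`), and for a C^{1,1} arc and small r the reverse inequality holds
(`IsRegularArc.exists_le_volume_thickening`). So a competitor whose closed r-neighbourhood covers
the tube around Γ is at least as long as Γ. A competitor no longer than Γ cannot cover it with a
radius s < r, since |B_r| shrinks strictly with the radius and λ does not grow.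

Upper bound: moving a ball from p to q sweeps out at most one new lune, of volume at most λ(r)|q -
p|. Chains of balls along arcs control the tube of each arc, and finitely many arcs, overlapping
only in endpoints, come as close as desired to all of T.

Lower bound: for small r the centres on the arc whose balls contain a given point form an interval
of parameters, so the lunes of successive balls are disjoint and their volumes add up. The lune
volume is subadditive in v and depends only on |v|, so by Fekete's argument short lunes nearly
attain the rate (`exists_forall_mul_le_lune`). The value of λ(r) is never computed. -/

/-! ### Volumes of lunes and their rate of growth -/

section Lune

open Metric Filter Topology Module
open scoped Pointwise

variable {E : Type*} [NormedAddCommGroup E] [InnerProductSpace ℝ E] [FiniteDimensional ℝ E]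
  [MeasurableSpace E] [BorelSpace E]

/-- The volume of the part of the ball of radius `r` around `v` outside the ball around `0`. -/
noncomputable def lune (r : ℝ) (v : E) : ℝ≥0∞ := volume (ball v r \ ball 0 r)

theorem volume_ball_diff_ball (r : ℝ) (p q : E) :
    volume (ball q r \ ball p r) = lune r (q - p) := by
  have h : (fun x => p + x) ⁻¹' (ball q r \ ball p r) = ball (q - p) r \ ball 0 r := by
    ext x
    simp only [mem_preimage, Set.mem_sdiff, mem_ball, dist_eq_norm, sub_zero, add_sub_cancel_left]
    rw [show p + x - q = x - (q - p) by abel]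
  rw [lune, ← h, measure_preimage_add]

theorem lune_zero (r : ℝ) : lune r (0 : E) = 0 := by
  simp [lune]

/-- The reflection that exchanges v and w preserves volume and the ball around 0. -/
theorem lune_eq_of_norm_eq (r : ℝ) {v w : E} (h : ‖v‖ = ‖w‖) : lune r v = lune r w := by
  set f := (ℝ ∙ (v - w))ᗮ.reflection
  have hf : f v = w := Submodule.reflection_sub h
  have hp : f ⁻¹' (ball w r \ ball 0 r) = ball v r \ ball 0 r := by
    ext x
    simp only [mem_preimage, Set.mem_sdiff, mem_ball, dist_zero_right, LinearIsometryEquiv.norm_map]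
    rw [← hf, f.dist_map]
  rw [lune, lune, ← hp, f.measurePreserving.measure_preimage
    (measurableSet_ball.diff measurableSet_ball).nullMeasurableSet]

/-- Insert the intermediate ball around v: a point of the large lune is either in that ball or not.
-/
theorem lune_add_le (r : ℝ) (v w : E) : lune r (v + w) ≤ lune r v + lune r w := by
  have h : volume (ball (v + w) r \ ball v r) = lune r w := by
    rw [volume_ball_diff_ball, add_sub_cancel_left]
  rw [← h, lune, lune]
  refine (measure_mono ?_).trans ((measure_union_le _ _).trans_eq (add_comm _ _))
  intro x hx
  by_cases hv : x ∈ ball v r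
  · exact Or.inr ⟨hv, hx.2⟩
  · exact Or.inl ⟨hx.1, hv⟩

theorem lune_nsmul_add_le (r : ℝ) (n : ℕ) (v w : E) :
    lune r (n • v + w) ≤ n * lune r v + lune r w := by
  induction n with
  | zero => simp
  | succ n ih =>
    rw [succ_nsmul', add_assoc]
    refine (lune_add_le r _ _).trans ?_
    push_cast
    rw [add_mul, one_mul, add_comm (_ * _), add_assoc]
    gcongr

theorem lune_mul_smul {a : ℝ} (ha : 0 < a) (r : ℝ) (v : E) :
    lune (a * r) (a • v) = ENNReal.ofReal (a ^ finrank ℝ E) * lune r v := by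
  have h (w : E) : a • ball w r = ball (a • w) (a * r) := by
    rw [_root_.smul_ball ha.ne', Real.norm_of_nonneg ha.le]
  have h0 := h 0
  rw [smul_zero] at h0
  rw [lune, lune, ← h, ← h0, ← smul_set_sdiff₀ ha.ne', Measure.addHaar_smul, abs_of_pos (by positivity)]

theorem tendsto_lune_zero {r : ℝ} (hr : 0 < r) : Tendsto (lune (E := E) r) (𝓝 0) (𝓝 0) := by
  rcases subsingleton_or_nontrivial E with hE | hE
  · refine tendsto_const_nhds.congr fun v => ?_
    rw [Subsingleton.elim v 0, lune_zero]
  have hb : volume (ball (0 : E) 1) ≠ ∞ := measure_ball_lt_top.ne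
  -- The lune lies in the shell between the radii r and r + ‖v‖.
  have key (v : E) : lune r v ≤ ENNReal.ofReal ((r + ‖v‖) ^ finrank ℝ E) * volume (ball (0 : E) 1)
      - ENNReal.ofReal (r ^ finrank ℝ E) * volume (ball (0 : E) 1) := by
    rw [← Measure.addHaar_ball volume (0 : E) hr.le,
      ← Measure.addHaar_ball volume (0 : E) (by positivity : 0 ≤ r + ‖v‖),
      ← measure_sdiff (ball_subset_ball (by linarith [norm_nonneg v]))
        measurableSet_ball.nullMeasurableSet measure_ball_lt_top.ne]
    refine measure_mono (sdiff_subset_sdiff_left (ball_subset_ball' ?_))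
    simp
  refine tendsto_of_tendsto_of_tendsto_of_le_of_le tendsto_const_nhds ?_ (fun v => zero_le) key
  have hc : Tendsto (fun v : E => ENNReal.ofReal ((r + ‖v‖) ^ finrank ℝ E)) (𝓝 0)
      (𝓝 (ENNReal.ofReal ((r + ‖(0 : E)‖) ^ finrank ℝ E))) :=
    (ENNReal.continuous_ofReal.comp (by fun_prop : Continuous fun v : E =>
      (r + ‖v‖) ^ finrank ℝ E)).tendsto 0
  rw [norm_zero, add_zero] at hc
  have := ENNReal.Tendsto.sub (ENNReal.Tendsto.mul_const hc (Or.inr hb))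
    (tendsto_const_nhds (x := ENNReal.ofReal (r ^ finrank ℝ E) * volume (ball (0 : E) 1)))
    (Or.inl (ENNReal.mul_ne_top ENNReal.ofReal_ne_top hb))
  rwa [tsub_self] at this

variable (E) in
/-- The largest ratio of `lune r v` to the length of `v`. -/
noncomputable def luneRate (r : ℝ) : ℝ≥0∞ := ⨆ v : E, lune r v / ‖v‖ₑ

theorem lune_le (r : ℝ) (v : E) : lune r v ≤ luneRate E r * ‖v‖ₑ := by
  rcases eq_or_ne v 0 with rfl | hv
  · simp [lune_zero]
  · rw [← ENNReal.div_le_iff (by simpa using hv) enorm_ne_top]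
    exact le_iSup (fun v : E => lune r v / ‖v‖ₑ) v

theorem luneRate_pos [Nontrivial E] {r : ℝ} (hr : 0 < r) : 0 < luneRate E r := by
  obtain ⟨v, hv⟩ := NormedSpace.exists_lt_norm ℝ E (2 * r)
  have hd : Disjoint (ball v r) (ball 0 r) := ball_disjoint_ball (by simpa using by linarith)
  have h1 : 0 < lune r v := by
    rw [lune, hd.sdiff_eq_left]
    exact measure_ball_pos _ _ hr
  refine pos_of_ne_zero fun h => ?_
  have := lune_le r v
  rw [h, zero_mul] at this
  exact absurd h1 (not_lt.2 this)

/-- Dilation by a multiplies lunes by a to the dimension and lengths by a, so one power cancels in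
the ratio. -/
theorem luneRate_mul_le [Nontrivial E] {a : ℝ} (ha : 0 < a) (r : ℝ) :
    luneRate E (a * r) ≤ ENNReal.ofReal (a ^ (finrank ℝ E - 1)) * luneRate E r := by
  refine iSup_le fun v => ENNReal.div_le_of_le_mul ?_
  have h := lune_mul_smul ha r (a⁻¹ • v)
  rw [smul_inv_smul₀ ha.ne'] at h
  have hd : a ^ finrank ℝ E = a ^ (finrank ℝ E - 1) * a := by
    rw [← pow_succ, Nat.sub_add_cancel finrank_pos]
  have hv : ENNReal.ofReal a * ‖a⁻¹ • v‖ₑ = ‖v‖ₑ := by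
    rw [← ofReal_norm, ← ofReal_norm, ← ENNReal.ofReal_mul ha.le, norm_smul, norm_inv,
      Real.norm_of_nonneg ha.le, mul_inv_cancel_left₀ ha.ne']
  calc lune (a * r) v = ENNReal.ofReal (a ^ finrank ℝ E) * lune r (a⁻¹ • v) := h
    _ ≤ ENNReal.ofReal (a ^ finrank ℝ E) * (luneRate E r * ‖a⁻¹ • v‖ₑ) := by
      gcongr; exact lune_le _ _
    _ = ENNReal.ofReal (a ^ (finrank ℝ E - 1)) * luneRate E r *
        (ENNReal.ofReal a * ‖a⁻¹ • v‖ₑ) := by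
      rw [hd, ENNReal.ofReal_mul (by positivity)]; ring
    _ = _ := by rw [hv]

/-- Fekete's lemma at zero for the subadditive function `lune r`. -/
theorem exists_forall_mul_le_lune {r : ℝ} (hr : 0 < r) {c : ℝ≥0∞} (hc : c < luneRate E r) :
    ∃ δ > 0, ∀ v : E, ‖v‖ < δ → c * ‖v‖ₑ ≤ lune r v := by
  obtain ⟨v₀, hv₀⟩ := lt_iSup_iff.1 hc
  have hne : v₀ ≠ 0 := by
    rintro rfl
    simp [lune_zero] at hv₀
  have hn0 : 0 < ‖v₀‖ := norm_pos_iff.2 hne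
  have hlt : c * ‖v₀‖ₑ < lune r v₀ :=
    (ENNReal.lt_div_iff_mul_lt (Or.inl (by simpa using hne)) (Or.inl enorm_ne_top)).1 hv₀
  have hev : ∀ᶠ w : E in 𝓝 0, lune r w < lune r v₀ - c * ‖v₀‖ₑ :=
    (tendsto_lune_zero hr).eventually (gt_mem_nhds (tsub_pos_of_lt hlt))
  obtain ⟨η, hη, hball⟩ := Metric.eventually_nhds_iff.1 hev
  refine ⟨min η ‖v₀‖, lt_min hη hn0, fun v hv => ?_⟩
  rcases eq_or_ne v 0 with rfl | hvne
  · simp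
  have hvp : 0 < ‖v‖ := norm_pos_iff.2 hvne
  -- Almost optimal v₀ is cut into n pieces of length ‖v‖ and a remainder shorter than ‖v‖ < η,
  -- whose lune is smaller than the slack in `hlt`. The pieces point along v₀ and not v, which is
  -- harmless because lunes depend only on the norm.
  set n : ℕ := ⌊‖v₀‖ / ‖v‖⌋₊ with hn
  have hn1 : 1 ≤ n := Nat.one_le_floor_iff _ |>.2
    ((one_le_div hvp).2 (hv.le.trans (min_le_right _ _)))
  have hle : n * ‖v‖ ≤ ‖v₀‖ := by
    rw [← le_div_iff₀ hvp]; exact Nat.floor_le (by positivity)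
  have hgt : ‖v₀‖ < (n + 1) * ‖v‖ := by
    rw [← div_lt_iff₀ hvp]; exact Nat.lt_floor_add_one _
  set e : E := ‖v₀‖⁻¹ • v₀ with he
  have hen : ‖e‖ = 1 := by rw [he, norm_smul, norm_inv, norm_norm, inv_mul_cancel₀ hn0.ne']
  have hdec : v₀ = n • (‖v‖ • e) + (‖v₀‖ - n * ‖v‖) • e := by
    rw [← Nat.cast_smul_eq_nsmul ℝ, smul_smul, ← add_smul, add_sub_cancel, he,
      smul_inv_smul₀ hn0.ne']
  have h1 := lune_nsmul_add_le r n (‖v‖ • e) ((‖v₀‖ - n * ‖v‖) • e)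
  rw [← hdec, lune_eq_of_norm_eq r (show ‖‖v‖ • e‖ = ‖v‖ by simp [norm_smul, hen])] at h1
  have h2 : lune r ((‖v₀‖ - n * ‖v‖) • e) < lune r v₀ - c * ‖v₀‖ₑ := by
    refine hball ?_
    rw [dist_zero_right, norm_smul, hen, mul_one, Real.norm_of_nonneg (by linarith)]
    have := hv.trans_le (min_le_left _ _)
    linarith
  have hfin : lune r v₀ ≠ ∞ := measure_ne_top_of_subset sdiff_subset measure_ball_lt_top.ne
  have h3 : c * ‖v₀‖ₑ ≤ n * lune r v := by
    have h4 : lune r v₀ ≤ n * lune r v + (lune r v₀ - c * ‖v₀‖ₑ) := h1.trans (by gcongr)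
    have h5 : c * ‖v₀‖ₑ + (lune r v₀ - c * ‖v₀‖ₑ) = lune r v₀ := add_tsub_cancel_of_le hlt.le
    nth_rewrite 1 [← h5] at h4
    exact (ENNReal.add_le_add_iff_right (ENNReal.sub_ne_top hfin)).1 h4
  have h6 : (n : ℝ≥0∞) * (c * ‖v‖ₑ) ≤ n * lune r v := by
    refine le_trans ?_ h3
    rw [mul_left_comm]
    gcongr
    rw [← ofReal_norm, ← ofReal_norm, ← ENNReal.ofReal_natCast, ← ENNReal.ofReal_mul (by positivity)]
    exact ENNReal.ofReal_le_ofReal hle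
  exact (ENNReal.mul_le_mul_iff_right (by exact_mod_cast (by omega : n ≠ 0))
    (ENNReal.natCast_ne_top n)).1 h6

end Lune

/-! ### Arcs in compact connected sets of finite length -/

section Arcs

open Metric Filter Topology

variable {X : Type*} [MetricSpace X]

theorem dist_le_mul_sub_of_dist_succ_le {p : ℕ → X} {ε : ℝ} (h : ∀ i, dist (p i) (p (i + 1)) ≤ ε)
    {i j : ℕ} (hij : i ≤ j) : dist (p i) (p j) ≤ ε * (j - i : ℝ) := by
  refine (dist_le_Ico_sum_of_dist_le hij (fun {k} _ _ => h k)).trans_eq ?_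
  rw [Finset.sum_const, Nat.card_Ico, nsmul_eq_mul, Nat.cast_sub hij, mul_comm]

/-- A shortest chain with steps of size at most `ε`: vertices that are not neighbours are separated. -/
theorem exists_separated_chain {T : Set X} (hT : IsPreconnected T) {x y : X} (hx : x ∈ T)
    (hy : y ∈ T) {ε : ℝ} (hε : 0 < ε) :
    ∃ (N : ℕ) (p : ℕ → X), p 0 = x ∧ p N = y ∧ (∀ i, p i ∈ T) ∧
      (∀ i, dist (p i) (p (i + 1)) ≤ ε) ∧ ∀ i j, i + 2 ≤ j → j ≤ N → ε ≤ dist (p i) (p j) := by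
  let G : SimpleGraph T :=
    { Adj := fun u v => u ≠ v ∧ dist u v < ε
      symm := ⟨fun u v h => ⟨h.1.symm, by rw [dist_comm]; exact h.2⟩⟩
      loopless := ⟨fun u h => h.1 rfl⟩ }
  have : PreconnectedSpace T := isPreconnected_iff_preconnectedSpace.1 hT
  have hreach (u v : T) : G.Reachable u v := by
    have : Std.Symm G.Reachable := ⟨fun _ _ h => h.symm⟩
    refine PreconnectedSpace.induction₂ G.Reachable (fun u => ?_) ⟨fun _ _ _ h h' => h.trans h'⟩ u v
    filter_upwards [ball_mem_nhds u hε] with v hv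
    rcases eq_or_ne u v with rfl | huv
    · exact SimpleGraph.Reachable.refl _
    · exact SimpleGraph.Adj.reachable ⟨huv, by rwa [mem_ball'] at hv⟩
  obtain ⟨w, hw⟩ := (hreach ⟨x, hx⟩ ⟨y, hy⟩).exists_walk_length_eq_dist
  refine ⟨w.length, fun i => w.getVert i, by simp, by simp, fun i => (w.getVert i).2, fun i => ?_,
    fun i j hij hj => ?_⟩
  · rcases lt_or_ge i w.length with hi | hi
    · exact (w.adj_getVert_succ hi).2.le
    · simp only [w.getVert_of_length_le hi, w.getVert_of_length_le (hi.trans (Nat.le_succ i)), dist_self]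
      exact hε.le
  -- A short jump from vertex i to vertex j ≥ i + 2 would yield a walk shorter than the shortest
  -- one.
  · by_contra! hlt
    have h1 : G.dist (w.getVert i) (w.getVert j) ≤ 1 := by
      rcases eq_or_ne (w.getVert i) (w.getVert j) with h | h
      · rw [h, SimpleGraph.dist_self]; exact zero_le_one
      · have hadj : G.Adj (w.getVert i) (w.getVert j) := ⟨h, hlt⟩
        exact (SimpleGraph.dist_eq_one_iff_adj.2 hadj).le
    have h2 := (hreach ⟨x, hx⟩ (w.getVert i)).dist_triangle_left ⟨y, hy⟩
    have h3 := (hreach (w.getVert i) (w.getVert j)).dist_triangle_left ⟨y, hy⟩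
    have h4 := SimpleGraph.dist_le (w.take i)
    have h5 := SimpleGraph.dist_le (w.drop j)
    rw [w.take_length] at h4
    rw [w.drop_length] at h5
    omega

/-- Pointwise limits, along an ultrafilter, of maps into a compact set that are asymptotically
Lipschitz. -/
theorem exists_lipschitz_limit {T S : Set X} (hT : IsCompact T) (hS : IsClosed S) {y : X} {C : ℝ}
    {c e : ℕ → ℝ} (hc : Tendsto c atTop (𝓝 C)) (he : Tendsto e atTop (𝓝 0)) {f : ℕ → ℝ → X}
    (hfT : ∀ n, ∀ t ∈ Icc (0 : ℝ) 1, f n t ∈ T) (hf0 : ∀ n, f n 0 ∈ S) (hf1 : ∀ n, f n 1 = y)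
    (hf : ∀ n, ∀ s ∈ Icc (0 : ℝ) 1, ∀ t ∈ Icc (0 : ℝ) 1,
      dist (f n s) (f n t) ≤ c n * |s - t| + e n) :
    ∃ g : ℝ → X, (∀ t ∈ Icc (0 : ℝ) 1, g t ∈ T) ∧ g 0 ∈ S ∧ g 1 = y ∧
      ∀ s ∈ Icc (0 : ℝ) 1, ∀ t ∈ Icc (0 : ℝ) 1, dist (g s) (g t) ≤ C * |s - t| := by
  -- One ultrafilter serves all t at once, so no diagonal subsequence is needed. Outside [0,1] the
  -- value y is a dummy.
  have hlim : ∀ t, ∃ z, t ∈ Icc (0 : ℝ) 1 →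
      z ∈ T ∧ Tendsto (fun n => f n t) (hyperfilter ℕ) (𝓝 z) := by
    intro t
    by_cases ht : t ∈ Icc (0 : ℝ) 1
    · obtain ⟨z, hz, hle⟩ := hT.ultrafilter_le_nhds ((hyperfilter ℕ).map fun n => f n t)
        (tendsto_principal.2 (Eventually.of_forall fun n => hfT n t ht))
      exact ⟨z, fun _ => ⟨hz, hle⟩⟩
    · exact ⟨y, fun h => absurd h ht⟩
  choose g hg using hlim
  have h0 : (0 : ℝ) ∈ Icc (0 : ℝ) 1 := ⟨le_rfl, zero_le_one⟩
  have h1 : (1 : ℝ) ∈ Icc (0 : ℝ) 1 := ⟨zero_le_one, le_rfl⟩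
  refine ⟨g, fun t ht => (hg t ht).1, hS.mem_of_tendsto (hg 0 h0).2 (Eventually.of_forall hf0),
    tendsto_nhds_unique (hg 1 h1).2 (by simp only [hf1]; exact tendsto_const_nhds), ?_⟩
  intro s hs t ht
  have hle : Tendsto (fun n => c n * |s - t| + e n) (hyperfilter ℕ) (𝓝 (C * |s - t|)) := by
    simpa using (((hc.mul_const _).add he).mono_left Nat.hyperfilter_le_atTop)
  exact le_of_tendsto_of_tendsto' ((hg s hs).2.dist (hg t ht).2) hle fun n => hf n s hs t ht

variable [MeasurableSpace X] [BorelSpace X]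

/-- The distance to x is 1-Lipschitz, and by connectedness it takes every value of [0, ρ] on this
part of T. -/
theorem ofReal_le_hausdorffMeasure_inter_closedBall {T : Set X} (hT : IsPreconnected T) {x y : X}
    (hx : x ∈ T) (hy : y ∈ T) {ρ : ℝ} (hρ : ρ ≤ dist x y) :
    ENNReal.ofReal ρ ≤ μH[1] (T ∩ closedBall x ρ) := by
  have hsub : Icc 0 ρ ⊆ dist x '' (T ∩ closedBall x ρ) := by
    intro t ht
    have hc : ContinuousOn (dist x) T := by fun_prop
    obtain ⟨z, hz, rfl⟩ := hT.intermediate_value hx hy hc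
      (show t ∈ Icc (dist x x) (dist x y) by rw [dist_self]; exact ⟨ht.1, ht.2.trans hρ⟩)
    exact ⟨z, ⟨hz, by rw [mem_closedBall']; exact ht.2⟩, rfl⟩
  have hl : LipschitzOnWith 1 (dist x) (T ∩ closedBall x ρ) :=
    (LipschitzWith.dist_right x).lipschitzOnWith
  calc ENNReal.ofReal ρ = μH[1] (Icc 0 ρ) := by
        rw [hausdorffMeasure_real, Real.volume_Icc, sub_zero]
    _ ≤ μH[1] (dist x '' (T ∩ closedBall x ρ)) := measure_mono hsub
    _ ≤ _ := by simpa using hl.hausdorffMeasure_image_le zero_le_one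

theorem edist_le_hausdorffMeasure {T : Set X} (hT : IsPreconnected T) {x y : X}
    (hx : x ∈ T) (hy : y ∈ T) : edist x y ≤ μH[1] T := by
  rw [edist_dist]
  exact (ofReal_le_hausdorffMeasure_inter_closedBall hT hx hy le_rfl).trans
    (measure_mono inter_subset_left)

/-- Balls of radius ε/3 around the vertices of even index are disjoint, and each contains length at
least ε/3 of T. The N/2 + 1 such balls give the factor 6; the term 2ε covers chains with N ≤ 2. -/
theorem length_mul_le_of_separated_chain {T : Set X} (hT : IsCompact T) (hTc : IsPreconnected T)
    (hfin : μH[1] T ≠ ∞) {ε : ℝ} (hε : 0 < ε) {N : ℕ} {p : ℕ → X} (hp : ∀ i, p i ∈ T)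
    (hsep : ∀ i j, i + 2 ≤ j → j ≤ N → ε ≤ dist (p i) (p j)) :
    N * ε ≤ 6 * (μH[1] T).toReal + 2 * ε := by
  rcases le_or_gt N 2 with hN | hN
  · have : (N : ℝ) ≤ 2 := by exact_mod_cast hN
    have := ENNReal.toReal_nonneg (a := μH[1] T)
    nlinarith
  have hfar (i : ℕ) (hi : 2 * i ≤ N) :
      ENNReal.ofReal (ε / 3) ≤ μH[1] (T ∩ closedBall (p (2 * i)) (ε / 3)) := by
    rcases Nat.eq_zero_or_pos i with rfl | hi0
    · exact ofReal_le_hausdorffMeasure_inter_closedBall hTc (hp _) (hp 2)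
        ((by linarith : ε / 3 ≤ ε).trans (hsep _ _ (by omega) (by omega)))
    · refine ofReal_le_hausdorffMeasure_inter_closedBall hTc (hp _) (hp 0)
        ((by linarith : ε / 3 ≤ ε).trans ?_)
      rw [dist_comm]
      exact hsep _ _ (by omega) hi
  have hdisj : Set.PairwiseDisjoint (Finset.range (N / 2 + 1) : Set ℕ)
      (fun i => T ∩ closedBall (p (2 * i)) (ε / 3)) := by
    have key : ∀ i j, i < j → j ≤ N / 2 → Disjoint (T ∩ closedBall (p (2 * i)) (ε / 3))
        (T ∩ closedBall (p (2 * j)) (ε / 3)) := fun i j hij hj =>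
      (closedBall_disjoint_closedBall (by
        have := hsep (2 * i) (2 * j) (by omega) (by omega)
        linarith)).mono inter_subset_right inter_subset_right
    intro i hi j hj hij
    simp only [Finset.coe_range, mem_Iio] at hi hj
    rcases lt_or_gt_of_ne hij with h | h
    · exact key i j h (by omega)
    · exact (key j i h (by omega)).symm
  have hsum : ((N / 2 + 1 : ℕ) : ℝ≥0∞) * ENNReal.ofReal (ε / 3) ≤ μH[1] T := by
    calc ((N / 2 + 1 : ℕ) : ℝ≥0∞) * ENNReal.ofReal (ε / 3)
        = ∑ _i ∈ Finset.range (N / 2 + 1), ENNReal.ofReal (ε / 3) := by simp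
      _ ≤ ∑ i ∈ Finset.range (N / 2 + 1), μH[1] (T ∩ closedBall (p (2 * i)) (ε / 3)) :=
        Finset.sum_le_sum fun i hi => hfar i (by rw [Finset.mem_range] at hi; omega)
      _ = μH[1] (⋃ i ∈ Finset.range (N / 2 + 1), T ∩ closedBall (p (2 * i)) (ε / 3)) :=
        (measure_biUnion_finset hdisj fun i _ =>
          hT.measurableSet.inter measurableSet_closedBall).symm
      _ ≤ μH[1] T := measure_mono (iUnion₂_subset fun i _ => inter_subset_left)
  have h := ENNReal.toReal_mono hfin hsum
  rw [ENNReal.toReal_mul, ENNReal.toReal_natCast, ENNReal.toReal_ofReal (by positivity)] at h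
  have hN2 : (N : ℝ) ≤ 2 * ((N / 2 + 1 : ℕ) : ℝ) := by
    exact_mod_cast (by omega : N ≤ 2 * (N / 2 + 1))
  nlinarith

/-- Run through a separated chain at constant speed: its number of steps is controlled by the length
of T, and rounding costs one jump ε. -/
theorem exists_coarse_path {T : Set X} (hT : IsCompact T) (hTc : IsPreconnected T)
    (hfin : μH[1] T ≠ ∞) {x y : X} (hx : x ∈ T) (hy : y ∈ T) {ε : ℝ} (hε : 0 < ε) :
    ∃ f : ℝ → X, (∀ t ∈ Icc (0 : ℝ) 1, f t ∈ T) ∧ f 0 = x ∧ f 1 = y ∧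
      ∀ s ∈ Icc (0 : ℝ) 1, ∀ t ∈ Icc (0 : ℝ) 1,
        dist (f s) (f t) ≤ (6 * (μH[1] T).toReal + 2 * ε) * |s - t| + ε := by
  obtain ⟨N, p, h0, hN, hp, hstep, hsep⟩ := exists_separated_chain hTc hx hy hε
  have hlen := length_mul_le_of_separated_chain hT hTc hfin hε hp hsep
  refine ⟨fun t => p ⌊t * N⌋₊, fun t _ => hp _, by simpa using h0, by simpa using hN, ?_⟩
  have key : ∀ s ∈ Icc (0 : ℝ) 1, ∀ t ∈ Icc (0 : ℝ) 1, s ≤ t → dist (p ⌊s * N⌋₊) (p ⌊t * N⌋₊) ≤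
      (6 * (μH[1] T).toReal + 2 * ε) * |s - t| + ε := by
    intro s hs t ht hst
    have hN0 : (0 : ℝ) ≤ N := N.cast_nonneg
    refine (dist_le_mul_sub_of_dist_succ_le hstep (Nat.floor_mono (by gcongr))).trans ?_
    have h1 : (⌊t * N⌋₊ : ℝ) ≤ t * N := Nat.floor_le (mul_nonneg ht.1 hN0)
    have h2 : s * N < ⌊s * N⌋₊ + 1 := Nat.lt_floor_add_one _
    rw [abs_sub_comm, abs_of_nonneg (sub_nonneg.2 hst)]
    calc ε * (⌊t * N⌋₊ - ⌊s * N⌋₊ : ℝ) ≤ ε * ((t - s) * N + 1) := by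
          gcongr; linarith
      _ = N * ε * (t - s) + ε := by ring
      _ ≤ _ := by
        have := sub_nonneg.2 hst
        gcongr
  intro s hs t ht
  rcases le_total s t with h | h
  · exact key s hs t ht h
  · rw [dist_comm, abs_sub_comm]
    exact key t ht s hs h

/-- A compact connected set of finite length contains an arc that joins a given point to a given
closed subset and meets the subset only at its starting point. -/
theorem exists_arc_to_closed {T S : Set X} (hT : IsCompact T) (hTc : IsPreconnected T)
    (hfin : μH[1] T ≠ ∞) (hS : IsClosed S) (hST : (T ∩ S).Nonempty) {y : X} (hy : y ∈ T)
    (hyS : y ∉ S) :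
    ∃ f : ℝ → X, (∀ t ∈ Icc (0 : ℝ) 1, f t ∈ T) ∧ f 0 ∈ S ∧ f 1 = y ∧
      ContinuousOn f (Icc 0 1) ∧ InjOn f (Icc 0 1) ∧ ∀ t ∈ Ioc (0 : ℝ) 1, f t ∉ S := by
  let P (C : ℝ) (f : ℝ → X) : Prop := (∀ t ∈ Icc (0 : ℝ) 1, f t ∈ T) ∧ f 0 ∈ S ∧ f 1 = y ∧
      ∀ s ∈ Icc (0 : ℝ) 1, ∀ t ∈ Icc (0 : ℝ) 1, dist (f s) (f t) ≤ C * |s - t|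
  -- Lipschitz constants on [0,1] of paths in T from S to y. A path attaining the infimum is a
  -- shortest one, so it has no loop and never returns to S.
  let A : Set ℝ := {C | 0 ≤ C ∧ ∃ f, P C f}
  have h0 : (0 : ℝ) ∈ Icc (0 : ℝ) 1 := ⟨le_rfl, zero_le_one⟩
  have h1 : (1 : ℝ) ∈ Icc (0 : ℝ) 1 := ⟨zero_le_one, le_rfl⟩
  have hne : A.Nonempty := by
    obtain ⟨x, hxT, hxS⟩ := hST
    choose f hfT hf0 hf1 hf using fun n : ℕ =>
      exists_coarse_path hT hTc hfin hxT hy (Nat.one_div_pos_of_nat (α := ℝ) (n := n))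
    have he := tendsto_one_div_add_atTop_nhds_zero_nat (𝕜 := ℝ)
    have hc : Tendsto (fun n : ℕ => 6 * (μH[1] T).toReal + 2 * (1 / ((n : ℝ) + 1))) atTop
        (𝓝 (6 * (μH[1] T).toReal)) := by
      simpa using (he.const_mul 2).const_add (6 * (μH[1] T).toReal)
    exact ⟨_, by positivity, exists_lipschitz_limit hT hS hc he hfT
      (fun n => by rw [hf0]; exact hxS) hf1 hf⟩
  have hbdd : BddBelow A := ⟨0, fun C hC => hC.1⟩
  obtain ⟨c, -, hc, hcA⟩ := exists_seq_tendsto_sInf hne hbdd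
  choose hc0 f hf using hcA
  obtain ⟨g, hgT, hgS, hg1, hg⟩ := exists_lipschitz_limit hT hS hc tendsto_const_nhds
    (fun n => (hf n).1) (fun n => (hf n).2.1) (fun n => (hf n).2.2.1)
    (fun n s hs t ht => by rw [add_zero]; exact (hf n).2.2.2 s hs t ht)
  set C := sInf A with hC
  have hC0 : 0 < C := by
    by_contra! hle
    have := hg 0 h0 1 h1
    rw [zero_sub, abs_neg, abs_one, mul_one, hg1] at this
    rw [dist_le_zero.1 (this.trans hle)] at hgS
    exact hyS hgS
  have hmin : ∀ C' < C, ∀ f, 0 ≤ C' → ¬ P C' f := fun C' hC' f h h' =>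
    absurd (csInf_le hbdd ⟨h, f, h'⟩) (not_le.2 hC')
  refine ⟨g, hgT, hgS, hg1, ?_, ?_, ?_⟩
  · have hl : LipschitzOnWith C.toNNReal g (Icc 0 1) :=
      LipschitzOnWith.of_dist_le_mul fun s hs t ht => by
        rw [Real.coe_toNNReal _ hC0.le, Real.dist_eq]; exact hg s hs t ht
    exact hl.continuousOn
  · have key : ∀ s ∈ Icc (0 : ℝ) 1, ∀ t ∈ Icc (0 : ℝ) 1, s < t → g s ≠ g t := by
      intro s hs t ht hst heq
      -- the path that omits the loop from `s` to `t`, at constant speed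
      set a := 1 - (t - s) with ha
      have ha0 : 0 ≤ a := by linarith [hs.1, ht.2]
      have hlt : a < 1 := by linarith
      let k : ℝ → ℝ := fun u => if a * u ≤ s then a * u else a * u + (t - s)
      have hk : ∀ u ∈ Icc (0 : ℝ) 1, k u ∈ Icc (0 : ℝ) 1 := by
        intro u hu
        have h2 : 0 ≤ a * u := mul_nonneg ha0 hu.1
        have h3 : a * u ≤ a := mul_le_of_le_one_right ha0 hu.2
        simp only [k]
        split_ifs
        · exact ⟨h2, by linarith⟩
        · exact ⟨by linarith, by linarith⟩
      have hkl : ∀ u ∈ Icc (0 : ℝ) 1, ∀ v ∈ Icc (0 : ℝ) 1, u ≤ v →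
          dist (g (k u)) (g (k v)) ≤ C * a * |u - v| := by
        intro u hu v hv huv
        have huv' : a * u ≤ a * v := by gcongr
        have habs : C * a * |u - v| = C * (a * v - a * u) := by
          rw [abs_sub_comm, abs_of_nonneg (sub_nonneg.2 huv)]; ring
        have hku := hk u hu
        have hkv := hk v hv
        rw [habs]
        simp only [k] at hku hkv ⊢
        split_ifs at hku hkv ⊢ with h2 h3 h3
        · refine (hg _ hku _ hkv).trans_eq ?_
          rw [abs_sub_comm, abs_of_nonneg (by linarith)]
        · have e1 := hg _ hku s hs
          have e2 := hg t ht _ hkv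
          rw [abs_sub_comm, abs_of_nonneg (by linarith)] at e1 e2
          refine (dist_triangle _ (g s) _).trans ?_
          nth_rewrite 2 [heq]
          calc _ ≤ _ := add_le_add e1 e2
            _ = _ := by ring
        · linarith
        · refine (hg _ hku _ hkv).trans_eq ?_
          rw [abs_sub_comm, abs_of_nonneg (by linarith)]
          ring
      refine hmin (C * a) (by nlinarith) (fun u => g (k u)) (by positivity)
        ⟨fun u hu => hgT _ (hk u hu), ?_, ?_, ?_⟩
      · simp only [k, mul_zero, if_pos hs.1]
        exact hgS
      · simp only [k, mul_one]
        -- If a ≤ s the omitted loop ends at t = 1, and the shortened path stops at s, where g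
        -- already equals y.
        split_ifs with h2
        · have e1 : t = 1 := by linarith [ht.2]
          have e2 : a = s := by linarith
          rw [e2, heq, e1, hg1]
        · rw [ha, sub_add_cancel, hg1]
      · intro u hu v hv
        rcases le_total u v with h | h
        · exact hkl u hu v hv h
        · rw [dist_comm, abs_sub_comm]
          exact hkl v hv u hu h
    intro s hs t ht heq
    rcases lt_trichotomy s t with h | h | h
    · exact absurd heq (key s hs t ht h)
    · exact h
    · exact absurd heq.symm (key t ht s hs h)
  · intro t ht htS
    have ht0 : 0 ≤ 1 - t := by linarith [ht.2]
    have hk : ∀ u ∈ Icc (0 : ℝ) 1, t + (1 - t) * u ∈ Icc (0 : ℝ) 1 := by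
      intro u hu
      have h2 : 0 ≤ (1 - t) * u := mul_nonneg ht0 hu.1
      have h3 : (1 - t) * u ≤ 1 - t := mul_le_of_le_one_right ht0 hu.2
      exact ⟨by linarith [ht.1], by linarith⟩
    refine hmin (C * (1 - t)) (by nlinarith [ht.1]) (fun u => g (t + (1 - t) * u)) (by positivity)
      ⟨fun u hu => hgT _ (hk u hu), by simpa using htS, by simpa using hg1, ?_⟩
    intro u hu v hv
    refine (hg _ (hk u hu) _ (hk v hv)).trans_eq ?_
    rw [add_sub_add_left_eq_sub, ← mul_sub, abs_mul, abs_of_nonneg ht0, mul_assoc]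

end Arcs

/-! ### Upper bound for the volume of a tube -/

section UpperBound

open Metric Filter Topology

/-- The open tube is the increasing union of tubes of radii u n < r, and the gap r - u n absorbs the
approximation error. -/
theorem measure_thickening_le_of_forall_exists {X : Type*} [PseudoMetricSpace X]
    [MeasurableSpace X] {μ : Measure X} {K : Set X} {r : ℝ} {a : ℝ≥0∞}
    (h : ∀ ε > 0, ∃ P : Set X, K ⊆ thickening ε P ∧ μ (thickening r P) ≤ a) :
    μ (thickening r K) ≤ a := by
  obtain ⟨u, hu, hur, hlim⟩ := exists_seq_strictMono_tendsto r
  have hsub : thickening r K ⊆ ⋃ n, thickening (u n) K := by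
    intro y hy
    obtain ⟨z, hz, hyz⟩ := mem_thickening_iff.1 hy
    obtain ⟨n, hn⟩ := (hlim.eventually (lt_mem_nhds hyz)).exists
    exact mem_iUnion.2 ⟨n, mem_thickening_iff.2 ⟨z, hz, hn⟩⟩
  have hmono : Monotone fun n => thickening (u n) K :=
    fun m n hmn => thickening_mono (hu.monotone hmn) K
  refine (measure_mono hsub).trans ?_
  rw [hmono.measure_iUnion]
  refine iSup_le fun n => ?_
  obtain ⟨P, hKP, hP⟩ := h (r - u n) (sub_pos.2 (hur n))
  refine (measure_mono ?_).trans hP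
  calc thickening (u n) K ⊆ thickening (u n) (thickening (r - u n) P) :=
        thickening_subset_of_subset _ hKP
    _ ⊆ thickening (u n + (r - u n)) P := thickening_thickening_subset _ _ _
    _ = thickening r P := by rw [add_sub_cancel]

theorem measurableSet_image_Ioc {X : Type*} [MetricSpace X] [MeasurableSpace X] [BorelSpace X]
    {f : ℝ → X} {s t : ℝ} (hf : ContinuousOn f (Icc s t)) (hinj : InjOn f (Icc s t)) :
    MeasurableSet (f '' Ioc s t) := by
  rcases le_or_gt s t with hst | hst
  · have h : f '' Ioc s t = f '' Icc s t \ {f s} := by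
      rw [← Icc_sdiff_left, hinj.image_sdiff_subset (singleton_subset_iff.2 ⟨le_rfl, hst⟩),
        image_singleton]
    rw [h]
    exact (isCompact_Icc.image_of_continuousOn hf).measurableSet.diff (measurableSet_singleton _)
  · rw [Ioc_eq_empty (by exact hst.not_gt), image_empty]
    exact MeasurableSet.empty

/-- Points are null for H¹, so an endpoint may be dropped; half-open pieces of an injective arc are
disjoint and their lengths add. -/
theorem edist_le_hausdorffMeasure_image_Ioc {X : Type*} [MetricSpace X] [MeasurableSpace X]
    [BorelSpace X] {f : ℝ → X} {s t : ℝ} (hst : s ≤ t) (hf : ContinuousOn f (Icc s t)) :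
    edist (f s) (f t) ≤ μH[1] (f '' Ioc s t) := by
  have := Measure.nullSingletonClass_hausdorff X (d := 1) one_pos
  calc edist (f s) (f t) ≤ μH[1] (f '' Icc s t) :=
        edist_le_hausdorffMeasure (isPreconnected_Icc.image f hf)
          (mem_image_of_mem f ⟨le_rfl, hst⟩) (mem_image_of_mem f ⟨hst, le_rfl⟩)
    _ = μH[1] ({f s} ∪ f '' Ioc s t) := by
        rw [← image_singleton, ← image_union, singleton_union, Ioc_insert_left hst]
    _ ≤ μH[1] {f s} + μH[1] (f '' Ioc s t) := measure_union_le _ _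
    _ = μH[1] (f '' Ioc s t) := by rw [measure_singleton, zero_add]

theorem sum_edist_le_hausdorffMeasure {X : Type*} [MetricSpace X] [MeasurableSpace X]
    [BorelSpace X] {f : ℝ → X} {a b : ℝ} (hf : ContinuousOn f (Icc a b))
    (hinj : InjOn f (Icc a b)) {t : ℕ → ℝ} (ht : Monotone t) {n : ℕ} (h0 : a ≤ t 0)
    (hn : t n ≤ b) :
    ∑ i ∈ Finset.range n, edist (f (t i)) (f (t (i + 1))) ≤ μH[1] (f '' Ioc a b) := by
  have hI (i : ℕ) (hi : i < n) : Icc (t i) (t (i + 1)) ⊆ Icc a b :=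
    Icc_subset_Icc (h0.trans (ht i.zero_le)) ((ht hi).trans hn)
  have hO (i : ℕ) (hi : i < n) : Ioc (t i) (t (i + 1)) ⊆ Ioc a b :=
    Ioc_subset_Ioc (h0.trans (ht i.zero_le)) ((ht hi).trans hn)
  have hdisj : Set.PairwiseDisjoint (Finset.range n : Set ℕ)
      fun i => f '' Ioc (t i) (t (i + 1)) := by
    intro i hi j hj hij
    simp only [Finset.coe_range, mem_Iio] at hi hj
    exact (ht.pairwise_disjoint_on_Ioc_succ hij).image hinj
      ((hO i hi).trans Ioc_subset_Icc_self) ((hO j hj).trans Ioc_subset_Icc_self)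
  calc ∑ i ∈ Finset.range n, edist (f (t i)) (f (t (i + 1)))
      ≤ ∑ i ∈ Finset.range n, μH[1] (f '' Ioc (t i) (t (i + 1))) :=
        Finset.sum_le_sum fun i hi => edist_le_hausdorffMeasure_image_Ioc (ht i.le_succ)
          (hf.mono (hI i (Finset.mem_range.1 hi)))
    _ = μH[1] (⋃ i ∈ Finset.range n, f '' Ioc (t i) (t (i + 1))) :=
        (measure_biUnion_finset hdisj fun i hi => measurableSet_image_Ioc
          (hf.mono (hI i (Finset.mem_range.1 hi))) (hinj.mono (hI i (Finset.mem_range.1 hi)))).symm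
    _ ≤ μH[1] (f '' Ioc a b) := measure_mono (iUnion₂_subset fun i hi =>
        image_mono (hO i (Finset.mem_range.1 hi)))

variable {E : Type*} [NormedAddCommGroup E] [InnerProductSpace ℝ E] [FiniteDimensional ℝ E]
  [MeasurableSpace E] [BorelSpace E]

theorem volume_thickening_insert_le (r : ℝ) {A : Set E} {p : E} (hp : p ∈ A) (q : E) :
    volume (thickening r (insert q A)) ≤ volume (thickening r A) + lune r (q - p) := by
  rw [← volume_ball_diff_ball]
  refine (measure_mono ?_).trans (measure_union_le _ _)
  intro y hy
  by_cases hyA : y ∈ thickening r A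
  · exact Or.inl hyA
  obtain ⟨z, hz, hyz⟩ := mem_thickening_iff.1 hy
  rcases hz with rfl | hz
  · exact Or.inr ⟨hyz, fun h => hyA (mem_thickening_iff.2 ⟨p, hp, h⟩)⟩
  · exact absurd (mem_thickening_iff.2 ⟨z, hz, hyz⟩) hyA

theorem volume_thickening_union_chain_le (r : ℝ) (A : Set E) (p : ℕ → E) (hp : p 0 ∈ A) (n : ℕ) :
    volume (thickening r (A ∪ p '' Iic n)) ≤
      volume (thickening r A) + ∑ i ∈ Finset.range n, lune r (p (i + 1) - p i) := by
  induction n with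
  | zero =>
    have : p '' Iic 0 ⊆ A := by
      rintro _ ⟨i, hi, rfl⟩
      rwa [Nat.le_zero.1 hi]
    simp [union_eq_self_of_subset_right this]
  | succ n ih =>
    have h : A ∪ p '' Iic (n + 1) = insert (p (n + 1)) (A ∪ p '' Iic n) := by
      rw [← Order.succ_eq_add_one, Order.Iic_succ, image_insert_eq, union_insert]
    rw [h, Finset.sum_range_succ, ← add_assoc]
    exact (volume_thickening_insert_le r (p := p n) (Or.inr ⟨n, mem_Iic.2 le_rfl, rfl⟩) _).trans (by gcongr)

theorem volume_thickening_union_arc_le (r : ℝ) {A : Set E} {f : ℝ → E}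
    (hf : ContinuousOn f (Icc 0 1)) (hinj : InjOn f (Icc 0 1)) (hfA : f 0 ∈ A) :
    volume (thickening r (A ∪ f '' Icc 0 1)) ≤
      volume (thickening r A) + luneRate E r * μH[1] (f '' Ioc 0 1) := by
  refine measure_thickening_le_of_forall_exists fun ε hε => ?_
  obtain ⟨δ, hδ, hfδ⟩ := Metric.uniformContinuousOn_iff.1
    (isCompact_Icc.uniformContinuousOn_of_continuous hf) ε hε
  obtain ⟨m, hm⟩ := exists_nat_one_div_lt hδ
  have hn0 : (0 : ℝ) < (m + 1 : ℕ) := by positivity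
  set t : ℕ → ℝ := fun i => i / (m + 1 : ℕ) with htdef
  have ht : Monotone t := fun i j hij => by simp only [t]; gcongr
  have ht1 : t (m + 1) = 1 := div_self hn0.ne'
  have ht0 : t 0 = 0 := by simp [t]
  refine ⟨A ∪ (f ∘ t) '' Iic (m + 1), ?_, ?_⟩
  · rintro y (hy | ⟨s, hs, rfl⟩)
    · exact self_subset_thickening hε _ (Or.inl hy)
    · set i := ⌊s * (m + 1 : ℕ)⌋₊ with hi
      have h1 : (i : ℝ) ≤ s * (m + 1 : ℕ) := Nat.floor_le (mul_nonneg hs.1 hn0.le)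
      have h2 : s * (m + 1 : ℕ) < i + 1 := Nat.lt_floor_add_one _
      have hi1 : i ≤ m + 1 := by
        have : (i : ℝ) ≤ (m + 1 : ℕ) := h1.trans (mul_le_of_le_one_left hn0.le hs.2)
        exact_mod_cast this
      refine mem_thickening_iff.2 ⟨f (t i), Or.inr ⟨i, hi1, rfl⟩,
        hfδ s hs (t i) ⟨ht0 ▸ ht i.zero_le, ht1 ▸ ht hi1⟩ ?_⟩
      have h3 : t i ≤ s := (div_le_iff₀ hn0).2 h1
      rw [Real.dist_eq, abs_of_nonneg (sub_nonneg.2 h3)]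
      refine lt_trans ?_ hm
      rw [← Nat.cast_succ, lt_div_iff₀ hn0, sub_mul, div_mul_cancel₀ _ hn0.ne']
      linarith
  · refine (volume_thickening_union_chain_le r A (f ∘ t) (by simpa [ht0] using hfA) _).trans ?_
    gcongr
    calc ∑ i ∈ Finset.range (m + 1), lune r ((f ∘ t) (i + 1) - (f ∘ t) i)
        ≤ ∑ i ∈ Finset.range (m + 1), luneRate E r * edist (f (t i)) (f (t (i + 1))) :=
          Finset.sum_le_sum fun i _ => by
            rw [edist_comm, edist_eq_enorm_sub]; exact lune_le _ _
      _ = luneRate E r * ∑ i ∈ Finset.range (m + 1), edist (f (t i)) (f (t (i + 1))) :=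
          (Finset.mul_sum _ _ _).symm
      _ ≤ luneRate E r * μH[1] (f '' Ioc 0 1) := by
          gcongr
          exact sum_edist_le_hausdorffMeasure hf hinj ht ht0.ge ht1.le

/-- Points of F are attached one at a time by arcs that meet the set built so far only at their
foot. Hence volume bound and length grow together, and no length is counted twice. -/
theorem exists_subset_volume_thickening_le (r : ℝ) {T : Set E} (hT : IsCompact T)
    (hTc : IsPreconnected T) (hfin : μH[1] T ≠ ∞) {x : E} (hx : x ∈ T) (F : Finset E)
    (hF : ∀ y ∈ F, y ∈ T) :
    ∃ S ⊆ T, IsCompact S ∧ x ∈ S ∧ (∀ y ∈ F, y ∈ S) ∧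
      volume (thickening r S) ≤ volume (ball (0 : E) r) + luneRate E r * μH[1] S := by
  classical
  induction F using Finset.induction_on with
  | empty =>
    refine ⟨{x}, singleton_subset_iff.2 hx, isCompact_singleton, rfl, by simp, ?_⟩
    rw [thickening_singleton, Measure.addHaar_ball_center]
    exact le_self_add
  | insert y F _ ih =>
    obtain ⟨S, hST, hS, hxS, hFS, hvol⟩ := ih fun z hz => hF z (Finset.mem_insert_of_mem hz)
    by_cases hyS : y ∈ S
    · exact ⟨S, hST, hS, hxS, by simpa [hyS] using hFS, hvol⟩
    obtain ⟨f, hfT, hf0, hf1, hfc, hinj, hfS⟩ := exists_arc_to_closed hT hTc hfin hS.isClosed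
      ⟨x, hx, hxS⟩ (hF y (Finset.mem_insert_self _ _)) hyS
    have hunion : S ∪ f '' Icc 0 1 = S ∪ f '' Ioc 0 1 := by
      rw [← Ioc_insert_left zero_le_one, image_insert_eq, union_insert, ← insert_union,
        insert_eq_of_mem hf0]
    have hdisj : Disjoint S (f '' Ioc 0 1) := by
      rw [Set.disjoint_right]
      rintro _ ⟨t, ht, rfl⟩
      exact hfS t ht
    refine ⟨S ∪ f '' Icc 0 1, union_subset hST (image_subset_iff.2 hfT),
      hS.union (isCompact_Icc.image_of_continuousOn hfc), Or.inl hxS, ?_, ?_⟩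
    · intro z hz
      rcases Finset.mem_insert.1 hz with rfl | hz
      · exact Or.inr ⟨1, ⟨zero_le_one, le_rfl⟩, hf1⟩
      · exact Or.inl (hFS z hz)
    · refine (volume_thickening_union_arc_le r hfc hinj hf0).trans ?_
      rw [hunion, measure_union hdisj (measurableSet_image_Ioc hfc hinj), mul_add, ← add_assoc]
      gcongr

/-- The volume of the neighbourhood of a compact connected set is at most that of a straight tube
of the same length. -/
theorem volume_thickening_le (r : ℝ) {T : Set E} (hT : IsCompact T) (hTc : IsConnected T)
    (hfin : μH[1] T ≠ ∞) :
    volume (thickening r T) ≤ volume (ball (0 : E) r) + luneRate E r * μH[1] T := by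
  obtain ⟨x, hx⟩ := hTc.nonempty
  refine measure_thickening_le_of_forall_exists fun ε hε => ?_
  obtain ⟨F, hFT, hF⟩ := hT.elim_nhds_subcover (fun y => ball y ε) fun y _ => ball_mem_nhds y hε
  obtain ⟨S, hST, -, -, hFS, hvol⟩ :=
    exists_subset_volume_thickening_le r hT hTc.isPreconnected hfin hx F hFT
  refine ⟨S, fun y hy => ?_, hvol.trans (by gcongr)⟩
  obtain ⟨z, hz, hyz⟩ := mem_iUnion₂.1 (hF hy)
  exact mem_thickening_iff.2 ⟨z, hFS z hz, hyz⟩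

end UpperBound

/-! ### Lower bound for thin tubes around regular arcs -/

section LowerBound

open Metric Filter Topology

variable {E : Type*} [NormedAddCommGroup E] [InnerProductSpace ℝ E]

/-- A regular arc with Lipschitz derivative `g`, bounded below by `m`. -/
structure IsRegularArc (γ g : ℝ → E) (a b K m : ℝ) : Prop where
  hasDeriv : ∀ t ∈ Icc a b, HasDerivWithinAt γ (g t) (Icc a b) t
  lipschitz : ∀ s ∈ Icc a b, ∀ t ∈ Icc a b, ‖g s - g t‖ ≤ K * |s - t|
  injOn : InjOn γ (Icc a b)
  lt : a < b
  K_pos : 0 < K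
  m_pos : 0 < m
  le_norm : ∀ t ∈ Icc a b, m ≤ ‖g t‖

namespace IsRegularArc

variable {γ g : ℝ → E} {a b K m : ℝ}

theorem continuousOn (h : IsRegularArc γ g a b K m) : ContinuousOn γ (Icc a b) :=
  fun t ht => (h.hasDeriv t ht).continuousWithinAt

/-- Mean value inequality for γ x - x • g t, whose derivative g x - g t is at most K|s - t| in norm.
-/
theorem norm_sub_sub_le (h : IsRegularArc γ g a b K m) {s t : ℝ} (hs : s ∈ Icc a b)
    (ht : t ∈ Icc a b) : ‖γ s - γ t - (s - t) • g t‖ ≤ K * |s - t| ^ 2 := by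
  have hsub : uIcc t s ⊆ Icc a b := uIcc_subset_Icc ht hs
  have hd : ∀ x ∈ uIcc t s, HasDerivWithinAt (fun x => γ x - x • g t) (g x - g t) (uIcc t s) x := by
    intro x hx
    have h1 := ((hasDerivWithinAt_id x (uIcc t s)).smul_const (g t))
    rw [one_smul] at h1
    exact ((h.hasDeriv x (hsub hx)).mono hsub).sub h1
  have hb : ∀ x ∈ uIcc t s, ‖g x - g t‖ ≤ K * |s - t| := fun x hx =>
    (h.lipschitz x (hsub hx) t ht).trans
      (mul_le_mul_of_nonneg_left (abs_sub_left_of_mem_uIcc hx) h.K_pos.le)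
  have := Convex.norm_image_sub_le_of_norm_hasDerivWithin_le hd hb (convex_uIcc t s)
    left_mem_uIcc right_mem_uIcc
  calc ‖γ s - γ t - (s - t) • g t‖ = ‖γ s - s • g t - (γ t - t • g t)‖ := by
        rw [sub_smul]; congr 1; abel
    _ ≤ _ := this
    _ = _ := by rw [Real.norm_eq_abs]; ring

theorem mul_le_norm_sub (h : IsRegularArc γ g a b K m) {s t : ℝ} (hs : s ∈ Icc a b)
    (ht : t ∈ Icc a b) : |s - t| * (‖g t‖ - K * |s - t|) ≤ ‖γ s - γ t‖ := by
  have h1 := h.norm_sub_sub_le hs ht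
  have h2 := norm_sub_norm_le ((s - t) • g t) (γ s - γ t)
  rw [norm_smul, Real.norm_eq_abs, norm_sub_rev (_ • _)] at h2
  nlinarith

theorem norm_sub_le (h : IsRegularArc γ g a b K m) {s t p q : ℝ} (hs : s ∈ Icc a b)
    (ht : t ∈ Icc a b) (hp : p ∈ Icc s t) (hq : q ∈ Icc s t) :
    ‖γ p - γ q‖ ≤ (‖g s‖ + K * (t - s)) * (t - s) := by
  have hst : s ≤ t := hp.1.trans hp.2
  have hsub : Icc s t ⊆ Icc a b := Icc_subset_Icc hs.1 ht.2
  have hb : ∀ x ∈ Icc s t, ‖g x‖ ≤ ‖g s‖ + K * (t - s) := by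
    intro x hx
    have h1 := h.lipschitz x (hsub hx) s hs
    rw [abs_of_nonneg (sub_nonneg.2 hx.1)] at h1
    have h2 := norm_le_norm_add_norm_sub' (g x) (g s)
    have h3 : K * (x - s) ≤ K * (t - s) :=
      mul_le_mul_of_nonneg_left (by linarith [hx.2]) h.K_pos.le
    linarith
  refine (Convex.norm_image_sub_le_of_norm_hasDerivWithin_le
    (fun x hx => (h.hasDeriv x (hsub hx)).mono hsub) hb (convex_Icc s t) hq hp).trans ?_
  have h0 : 0 ≤ ‖g s‖ + K * (t - s) := (norm_nonneg _).trans (hb s ⟨le_rfl, hst⟩)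
  refine mul_le_mul_of_nonneg_left ?_ h0
  rw [Real.norm_eq_abs, abs_le]
  constructor <;> linarith [hp.1, hp.2, hq.1, hq.2]

/-- If y and γ s lie, to first order, on opposite sides of the normal hyperplane at γ t, then γ t is
not a worse centre for y than γ s. The second-order error is beaten by ‖q‖²: with the constants 16
and 8, each of the terms r K H² and ‖q‖ K H² is at most ‖q‖²/4. -/
theorem mem_ball_of_inner_nonpos (h : IsRegularArc γ g a b K m) {s t r : ℝ} (hs : s ∈ Icc a b)
    (ht : t ∈ Icc a b) (hr : 16 * K * r ≤ m ^ 2) (hst : 8 * K * |s - t| ≤ m) {y : E}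
    (hy : y ∈ ball (γ s) r) (hin : (s - t) * inner ℝ (y - γ t) (g t) ≤ 0) : y ∈ ball (γ t) r := by
  rw [mem_ball, dist_eq_norm] at hy ⊢
  by_contra! hw
  have hr0 : 0 < r := (norm_nonneg _).trans_lt hy
  have hK := h.K_pos
  have hm := h.m_pos
  have hgm := h.le_norm t ht
  set q := γ s - γ t with hq
  set e := q - (s - t) • g t with he
  have heK : ‖e‖ ≤ K * |s - t| ^ 2 := h.norm_sub_sub_le hs ht
  have hQ := h.mul_le_norm_sub hs ht
  rw [← hq] at hQ
  have hH : 0 ≤ |s - t| := abs_nonneg _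
  set H := |s - t|
  have hexp : ‖y - γ s‖ ^ 2 = ‖y - γ t‖ ^ 2 - 2 * inner ℝ (y - γ t) q + ‖q‖ ^ 2 := by
    rw [← norm_sub_sq_real, hq]; congr 2; abel
  have hinner : inner ℝ (y - γ t) q ≤ ‖y - γ t‖ * ‖e‖ := by
    have h1 : q = (s - t) • g t + e := by rw [he]; abel
    rw [h1, inner_add_right, real_inner_smul_right]
    have := real_inner_le_norm (y - γ t) e
    linarith
  have hwq : ‖y - γ t‖ ≤ r + ‖q‖ := by
    have h1 : y - γ t = (y - γ s) + q := by rw [hq]; abel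
    rw [h1]
    exact (norm_add_le _ _).trans (by gcongr)
  have hQ0 : 0 ≤ ‖q‖ := norm_nonneg _
  have hlt : ‖y - γ s‖ ^ 2 < ‖y - γ t‖ ^ 2 := by
    have := norm_nonneg (y - γ s)
    nlinarith
  have hwe : ‖y - γ t‖ * ‖e‖ ≤ (r + ‖q‖) * (K * H ^ 2) :=
    mul_le_mul hwq heK (norm_nonneg _) (by positivity)
  have hmH : m * H ≤ 2 * ‖q‖ := by nlinarith
  have hmH2 : m ^ 2 * H ^ 2 ≤ 4 * ‖q‖ ^ 2 := by
    have := mul_self_le_mul_self (by positivity) hmH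
    nlinarith
  have h1 : 16 * K * r * H ^ 2 ≤ m ^ 2 * H ^ 2 := by gcongr
  have h2 : 8 * K * H * (‖q‖ * H) ≤ m * (‖q‖ * H) := by gcongr
  have h3 : ‖q‖ * (m * H) ≤ ‖q‖ * (2 * ‖q‖) := by gcongr
  nlinarith

theorem exists_forall_le_dist (h : IsRegularArc γ g a b K m) {δ : ℝ} (hδ : 0 < δ) :
    ∃ ρ > 0, ∀ s ∈ Icc a b, ∀ t ∈ Icc a b, δ ≤ |s - t| → ρ ≤ dist (γ s) (γ t) := by
  set A : Set (ℝ × ℝ) := (Icc a b ×ˢ Icc a b) ∩ {p | δ ≤ |p.1 - p.2|} with hA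
  have hAc : IsCompact A := (isCompact_Icc.prod isCompact_Icc).inter_right
    (isClosed_le continuous_const (by fun_prop))
  rcases A.eq_empty_or_nonempty with hne | hne
  · refine ⟨1, one_pos, fun s hs t ht hst => ?_⟩
    exact absurd (show (s, t) ∈ A from ⟨⟨hs, ht⟩, hst⟩) (by simp [hne])
  have hc : ContinuousOn (fun p : ℝ × ℝ => dist (γ p.1) (γ p.2)) A :=
    continuous_dist.comp_continuousOn
      ((h.continuousOn.comp continuousOn_fst fun p hp => hp.1.1).prodMk
        (h.continuousOn.comp continuousOn_snd fun p hp => hp.1.2))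
  obtain ⟨p, hp, hmin⟩ := hAc.exists_isMinOn hne hc
  refine ⟨dist (γ p.1) (γ p.2), dist_pos.2 fun heq => ?_, fun s hs t ht hst =>
    hmin (show (s, t) ∈ A from ⟨⟨hs, ht⟩, hst⟩)⟩
  have h1 := h.injOn hp.1.1 hp.1.2 heq
  have h2 : δ ≤ |p.1 - p.2| := hp.2
  rw [h1, sub_self, abs_zero] at h2
  exact absurd hδ (not_lt.2 h2)

/-- For small radii, the parameters of the balls that contain a given point form an interval. -/
theorem exists_ball_inter_ball_subset (h : IsRegularArc γ g a b K m) :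
    ∃ r₀ > 0, ∀ r < r₀, ∀ s ∈ Icc a b, ∀ u ∈ Icc a b, ∀ t ∈ Icc s u,
      ball (γ s) r ∩ ball (γ u) r ⊆ ball (γ t) r := by
  have hK := h.K_pos
  have hm := h.m_pos
  -- Injectivity excludes distant parameters: balls of radius r < ρ/2 with a common point have
  -- parameters closer than m/(8K), the range where `mem_ball_of_inner_nonpos` applies.
  obtain ⟨ρ, hρ, hdist⟩ := h.exists_forall_le_dist (δ := m / (8 * K)) (by positivity)
  refine ⟨min (ρ / 2) (m ^ 2 / (16 * K)), by positivity, ?_⟩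
  rintro r hr s hs u hu t ht y ⟨hys, hyu⟩
  have hr1 := hr.trans_le (min_le_left _ _)
  have hr2 := hr.le.trans (min_le_right _ _)
  rw [le_div_iff₀ (by positivity)] at hr2
  have hsu : |s - u| < m / (8 * K) := by
    by_contra! hle
    have h1 := hdist s hs u hu hle
    have h2 := dist_triangle_left (γ s) (γ u) y
    rw [mem_ball] at hys hyu
    linarith
  rw [lt_div_iff₀ (by positivity), abs_sub_comm,
    abs_of_nonneg (sub_nonneg.2 (ht.1.trans ht.2))] at hsu
  have htab : t ∈ Icc a b := ⟨hs.1.trans ht.1, ht.2.trans hu.2⟩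
  have h1 := sub_nonneg.2 ht.1
  have h2 := sub_nonneg.2 ht.2
  -- The side of the normal hyperplane on which y lies decides which endpoint is across from it.
  rcases le_total (inner ℝ (y - γ t) (g t)) 0 with hin | hin
  · refine h.mem_ball_of_inner_nonpos hu htab (by linarith) ?_ hyu
      (mul_nonpos_of_nonneg_of_nonpos h2 hin)
    rw [abs_of_nonneg h2]
    nlinarith
  · refine h.mem_ball_of_inner_nonpos hs htab (by linarith) ?_ hys
      (mul_nonpos_of_nonpos_of_nonneg (by linarith) hin)
    rw [abs_sub_comm, abs_of_nonneg h1]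
    nlinarith

/-- Hausdorff measure is estimated by diameters of pieces, lunes by chords; on short pieces the two
agree up to 1 + ε. The condition `hδ` says that (‖g s‖ + Kτ)/(‖g s‖ - Kτ) ≤ 1 + ε with τ = t - s. -/
theorem ediam_image_Icc_le (h : IsRegularArc γ g a b K m) {s t ε : ℝ} (hs : s ∈ Icc a b)
    (ht : t ∈ Icc a b) (hst : s ≤ t) (hε : 0 < ε) (hδ : K * (t - s) * (2 + ε) ≤ ε * m) :
    ediam (γ '' Icc s t) ≤ ENNReal.ofReal (1 + ε) * ‖γ t - γ s‖ₑ := by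
  refine ediam_le ?_
  rintro _ ⟨p, hp, rfl⟩ _ ⟨q, hq, rfl⟩
  rw [← ofReal_norm, ← ENNReal.ofReal_mul (by positivity), edist_dist, dist_eq_norm]
  refine ENNReal.ofReal_le_ofReal ((h.norm_sub_le hs ht hp hq).trans ?_)
  have h1 := h.mul_le_norm_sub ht hs
  rw [abs_of_nonneg (sub_nonneg.2 hst)] at h1
  have h2 := h.le_norm s hs
  have h3 : ‖g s‖ + K * (t - s) ≤ (1 + ε) * (‖g s‖ - K * (t - s)) := by nlinarith
  have h4 := mul_le_mul_of_nonneg_right h3 (sub_nonneg.2 hst)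
  have h5 : (1 + ε) * ((t - s) * (‖g s‖ - K * (t - s))) ≤ (1 + ε) * ‖γ t - γ s‖ := by gcongr
  linarith

theorem exists_lipschitzOnWith (h : IsRegularArc γ g a b K m) :
    ∃ C, LipschitzOnWith C γ (Icc a b) := by
  have hb : ∀ x ∈ Icc a b, ‖g x‖ ≤ ‖g a‖ + K * (b - a) := by
    intro x hx
    have h1 := h.lipschitz x hx a ⟨le_rfl, h.lt.le⟩
    rw [abs_of_nonneg (sub_nonneg.2 hx.1)] at h1
    have h2 := norm_le_norm_add_norm_sub' (g x) (g a)
    have h3 : K * (x - a) ≤ K * (b - a) :=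
      mul_le_mul_of_nonneg_left (by linarith [hx.2]) h.K_pos.le
    linarith
  exact ⟨_, Convex.lipschitzOnWith_of_nnnorm_hasDerivWithin_le (C := (‖g a‖ + K * (b - a)).toNNReal)
    (convex_Icc a b) h.hasDeriv fun x hx => by
      rw [← NNReal.coe_le_coe, coe_nnnorm]; exact (hb x hx).trans (Real.le_coe_toNNReal _)⟩

end IsRegularArc

variable [FiniteDimensional ℝ E] [MeasurableSpace E] [BorelSpace E]

/-- By the hypothesis a point of the newest ball that lies in any earlier ball also lies in the
previous one, so each new lune is disjoint from the earlier balls. -/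
theorem volume_ball_add_sum_lune_le (r : ℝ) (p : ℕ → E) (n : ℕ)
    (hp : ∀ i j k, i ≤ j → j ≤ k → k ≤ n → ball (p i) r ∩ ball (p k) r ⊆ ball (p j) r) :
    volume (ball (0 : E) r) + ∑ i ∈ Finset.range n, lune r (p (i + 1) - p i) ≤
      volume (thickening r (p '' Iic n)) := by
  induction n with
  | zero =>
    have h : p '' Iic 0 = {p 0} := by
      rw [show Iic 0 = {0} by ext; simp, image_singleton]
    rw [h, thickening_singleton, Measure.addHaar_ball_center volume (p 0)]
    simp
  | succ n ih =>
    have hd : Disjoint (thickening r (p '' Iic n)) (ball (p (n + 1)) r \ ball (p n) r) := by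
      rw [Set.disjoint_left]
      intro y hy hy'
      obtain ⟨_, ⟨i, hi, rfl⟩, hyi⟩ := mem_thickening_iff.1 hy
      exact hy'.2 (hp i n (n + 1) hi n.le_succ le_rfl ⟨hyi, hy'.1⟩)
    rw [Finset.sum_range_succ, ← add_assoc, ← volume_ball_diff_ball]
    calc _ ≤ volume (thickening r (p '' Iic n)) + volume (ball (p (n + 1)) r \ ball (p n) r) := by
          gcongr
          exact ih fun i j k hij hjk hk => hp i j k hij hjk (hk.trans n.le_succ)
      _ = volume (thickening r (p '' Iic n) ∪ (ball (p (n + 1)) r \ ball (p n) r)) :=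
          (measure_union hd (measurableSet_ball.diff measurableSet_ball)).symm
      _ ≤ _ := by
          refine measure_mono (union_subset (thickening_subset_of_subset _
            (image_mono (Iic_subset_Iic.2 n.le_succ))) ?_)
          intro y hy
          exact mem_thickening_iff.2 ⟨_, ⟨n + 1, mem_Iic.2 le_rfl, rfl⟩, hy.1⟩

theorem IsRegularArc.mul_hausdorffMeasure_le {γ g : ℝ → E} {a b K m : ℝ}
    (h : IsRegularArc γ g a b K m) {r : ℝ} (hr : 0 < r)
    (hball : ∀ s ∈ Icc a b, ∀ u ∈ Icc a b, ∀ t ∈ Icc s u,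
      ball (γ s) r ∩ ball (γ u) r ⊆ ball (γ t) r)
    {c : ℝ≥0∞} (hc : c < luneRate E r) {ε : ℝ} (hε : 0 < ε) :
    c * μH[1] (γ '' Icc a b) ≤ ENNReal.ofReal (1 + ε) *
      (volume (thickening r (γ '' Icc a b)) - volume (ball (0 : E) r)) := by
  set Z := volume (thickening r (γ '' Icc a b)) - volume (ball (0 : E) r) with hZ
  rcases eq_or_ne c 0 with rfl | hc0
  · simp
  have hctop : c ≠ ∞ := hc.ne_top
  have hab := sub_pos.2 h.lt
  obtain ⟨C, hC⟩ := h.exists_lipschitzOnWith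
  obtain ⟨δ, hδ, hlune⟩ := exists_forall_mul_le_lune hr hc
  let t (n i : ℕ) : ℝ := a + (b - a) / (n + 1) * i
  have htm (n : ℕ) : Monotone (t n) := fun i j hij => by
    simp only [t]; gcongr
  have ht0 (n : ℕ) : t n 0 = a := by simp [t]
  have ht1 (n : ℕ) : t n (n + 1) = b := by
    have : (n : ℝ) + 1 ≠ 0 := by positivity
    simp only [t]; push_cast; rw [div_mul_cancel₀ _ this]; ring
  have htI (n i : ℕ) (hi : i ≤ n + 1) : t n i ∈ Icc a b :=
    ⟨ht0 n ▸ htm n i.zero_le, ht1 n ▸ htm n hi⟩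
  have hstep (n i : ℕ) : t n (i + 1) - t n i = (b - a) / (n + 1) := by
    simp only [t]; push_cast; ring
  have hlim : Tendsto (fun n : ℕ => (b - a) / ((n : ℝ) + 1)) atTop (𝓝 0) := by
    simpa [div_eq_mul_inv] using
      (tendsto_one_div_add_atTop_nhds_zero_nat (𝕜 := ℝ)).const_mul (b - a)
  have hdiam (n : ℕ) (i : Fin (n + 1)) : ediam (γ '' Icc (t n i) (t n (i + 1))) ≤
      ENNReal.ofReal (C * ((b - a) / (n + 1))) := by
    refine ediam_le ?_
    rintro _ ⟨p, hp, rfl⟩ _ ⟨q, hq, rfl⟩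
    have hsub : Icc (t n i) (t n (i + 1)) ⊆ Icc a b :=
      Icc_subset_Icc (htI n i i.2.le).1 (htI n (i + 1) i.2).2
    rw [edist_dist]
    refine ENNReal.ofReal_le_ofReal ((hC.dist_le_mul p (hsub hp) q (hsub hq)).trans ?_)
    rw [← hstep n i]
    gcongr
    rw [Real.dist_eq, abs_le]
    constructor <;> linarith [hp.1, hp.2, hq.1, hq.2]
  have hcover (n : ℕ) : γ '' Icc a b ⊆ ⋃ i : Fin (n + 1), γ '' Icc (t n i) (t n (i + 1)) := by
    rintro _ ⟨x, hx, rfl⟩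
    rw [mem_iUnion]
    have hex : ∃ i, x ≤ t n (i + 1) := ⟨n, by rw [ht1]; exact hx.2⟩
    classical
    have hlt : Nat.find hex < n + 1 := Nat.lt_succ_of_le (Nat.find_min' hex (by rw [ht1]; exact hx.2))
    refine ⟨⟨Nat.find hex, hlt⟩, x, ⟨?_, Nat.find_spec hex⟩, rfl⟩
    rcases Nat.eq_zero_or_pos (Nat.find hex) with h0 | h0
    · simp only [h0, ht0]; exact hx.1
    · have h1 := Nat.find_min hex (Nat.sub_one_lt h0.ne')
      rw [Nat.sub_add_cancel h0, not_le] at h1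
      exact h1.le
  -- On a fine mesh, diameters are at most 1 + ε times the chords (`e1`), and chords are short
  -- enough for their lunes to have rate at least c (`e2`).
  have hsum : ∀ᶠ n : ℕ in atTop,
      ∑ i : Fin (n + 1), ediam (γ '' Icc (t n i) (t n (i + 1))) ^ (1 : ℝ) ≤
        ENNReal.ofReal (1 + ε) * Z / c := by
    have e1 : ∀ᶠ n : ℕ in atTop, K * ((b - a) / ((n : ℝ) + 1)) * (2 + ε) < ε * m := by
      have := (hlim.const_mul K).mul_const (2 + ε)
      rw [mul_zero, zero_mul] at this
      exact this.eventually (gt_mem_nhds (mul_pos hε h.m_pos))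
    have e2 : ∀ᶠ n : ℕ in atTop, C * ((b - a) / ((n : ℝ) + 1)) < δ := by
      have := hlim.const_mul (C : ℝ)
      rw [mul_zero] at this
      exact this.eventually (gt_mem_nhds hδ)
    filter_upwards [e1, e2] with n hn1 hn2
    rw [ENNReal.le_div_iff_mul_le (Or.inl hc0) (Or.inl hctop), mul_comm, Finset.mul_sum]
    have hV := volume_ball_add_sum_lune_le r (γ ∘ t n) (n + 1) fun i j k hij hjk hk =>
      hball _ (htI n i (hij.trans (hjk.trans hk))) _ (htI n k hk) _ ⟨htm n hij, htm n hjk⟩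
    have hZ' : ∑ i ∈ Finset.range (n + 1), lune r (γ (t n (i + 1)) - γ (t n i)) ≤ Z := by
      refine ENNReal.le_sub_of_add_le_left measure_ball_lt_top.ne (hV.trans (measure_mono
        (thickening_subset_of_subset _ ?_)))
      rintro _ ⟨i, hi, rfl⟩
      exact ⟨t n i, htI n i hi, rfl⟩
    calc ∑ i : Fin (n + 1), c * ediam (γ '' Icc (t n i) (t n (i + 1))) ^ (1 : ℝ)
        ≤ ∑ i : Fin (n + 1), ENNReal.ofReal (1 + ε) * lune r (γ (t n (i + 1)) - γ (t n i)) := by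
          refine Finset.sum_le_sum fun i _ => ?_
          have hi0 := htI n i i.2.le
          have hi1 := htI n (i + 1) i.2
          have hle : ‖γ (t n (i + 1)) - γ (t n i)‖ < δ := by
            have := hC.dist_le_mul _ hi1 _ hi0
            rw [dist_eq_norm, Real.dist_eq, hstep, abs_of_pos (by positivity)] at this
            exact this.trans_lt hn2
          rw [ENNReal.rpow_one]
          calc c * ediam (γ '' Icc (t n i) (t n (i + 1)))
              ≤ c * (ENNReal.ofReal (1 + ε) * ‖γ (t n (i + 1)) - γ (t n i)‖ₑ) := by
                gcongr
                exact h.ediam_image_Icc_le hi0 hi1 (htm n (Nat.le_succ _)) hε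
                  (by rw [hstep]; exact hn1.le)
            _ = ENNReal.ofReal (1 + ε) * (c * ‖γ (t n (i + 1)) - γ (t n i)‖ₑ) := by ring
            _ ≤ _ := by gcongr; exact hlune _ hle
      _ = ENNReal.ofReal (1 + ε) *
          ∑ i ∈ Finset.range (n + 1), lune r (γ (t n (i + 1)) - γ (t n i)) := by
          rw [← Finset.mul_sum,
            Fin.sum_univ_eq_sum_range (fun i => lune r (γ (t n (i + 1)) - γ (t n i)))]
      _ ≤ _ := by gcongr
  have hr0 : Tendsto (fun n : ℕ => ENNReal.ofReal (C * ((b - a) / ((n : ℝ) + 1)))) atTop (𝓝 0) := by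
    have := (ENNReal.continuous_ofReal.tendsto _).comp (hlim.const_mul (C : ℝ))
    rw [mul_zero, ENNReal.ofReal_zero] at this
    exact this
  have hH := Measure.hausdorffMeasure_le_liminf_sum 1 (γ '' Icc a b) _ hr0
    (fun n (i : Fin (n + 1)) => γ '' Icc (t n i) (t n (i + 1)))
    (Eventually.of_forall hdiam) (Eventually.of_forall hcover)
  have hle := hH.trans (liminf_le_of_frequently_le' hsum.frequently)
  rw [ENNReal.le_div_iff_mul_le (Or.inl hc0) (Or.inl hctop), mul_comm] at hle
  exact hle

/-- The volume of a thin neighbourhood of a regular arc is at least that of a straight tube of the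
same length. -/
theorem IsRegularArc.exists_le_volume_thickening {γ g : ℝ → E} {a b K m : ℝ}
    (h : IsRegularArc γ g a b K m) :
    ∃ r₀ > 0, ∀ r, 0 < r → r < r₀ →
      volume (ball (0 : E) r) + luneRate E r * μH[1] (γ '' Icc a b) ≤
        volume (thickening r (γ '' Icc a b)) := by
  obtain ⟨r₀, hr₀, hball⟩ := h.exists_ball_inter_ball_subset
  refine ⟨r₀, hr₀, fun r hr hrr => ?_⟩
  have hsub : volume (ball (0 : E) r) ≤ volume (thickening r (γ '' Icc a b)) := by
    rw [← Measure.addHaar_ball_center volume (γ a)]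
    exact measure_mono (ball_subset_thickening (mem_image_of_mem γ (left_mem_Icc.2 h.lt.le)) r)
  set Z := volume (thickening r (γ '' Icc a b)) - volume (ball (0 : E) r) with hZ
  have key : ∀ c < luneRate E r, c * μH[1] (γ '' Icc a b) ≤ Z := by
    intro c hc
    have hlim : Tendsto (fun ε : ℝ => ENNReal.ofReal (1 + ε) * Z) (𝓝[>] 0) (𝓝 Z) := by
      have h1 : Tendsto (fun ε : ℝ => ENNReal.ofReal (1 + ε)) (𝓝[>] 0) (𝓝 1) := by
        have : Continuous fun ε : ℝ => ENNReal.ofReal (1 + ε) :=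
          ENNReal.continuous_ofReal.comp (continuous_const.add continuous_id)
        simpa using (this.tendsto 0).mono_left nhdsWithin_le_nhds
      simpa using ENNReal.Tendsto.mul_const h1 (Or.inl one_ne_zero)
    refine ge_of_tendsto hlim ?_
    filter_upwards [self_mem_nhdsWithin] with ε hε
    exact h.mul_hausdorffMeasure_le hr (hball r hrr) hc hε
  -- Approaching both factors from below avoids assuming that the rate is finite.
  have hZ' : luneRate E r * μH[1] (γ '' Icc a b) ≤ Z :=
    ENNReal.mul_le_of_forall_lt fun c hc l hl =>
      (mul_le_mul_right hl.le c).trans (key c hc)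
  calc _ ≤ volume (ball (0 : E) r) + Z := by gcongr
    _ = _ := add_tsub_cancel_of_le hsub

end LowerBound

/-! ### Comparison of competitors with the curve -/

section Minimality

open Metric Filter Topology Module

theorem exists_infDist_eq {E : Type*} [NormedAddCommGroup E] [NormedSpace ℝ E] [Nontrivial E]
    {S : Set E} (hS : Bornology.IsBounded S) (hne : S.Nonempty) {r : ℝ} (hr : 0 ≤ r) :
    ∃ y, infDist y S = r := by
  obtain ⟨x, hx⟩ := hne
  obtain ⟨R, hR⟩ := hS.subset_closedBall 0
  obtain ⟨z, hz⟩ := NormedSpace.exists_lt_norm ℝ E (R + r)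
  have hrz : r ≤ infDist z S := by
    refine (le_infDist ⟨x, hx⟩).2 fun w hw => ?_
    have h1 : ‖w‖ ≤ R := by simpa using hR hw
    have h2 := norm_sub_norm_le z w
    rw [dist_eq_norm]
    linarith
  have h0 : infDist x S ≤ r := by rw [infDist_zero_of_mem hx]; exact hr
  obtain ⟨y, -, hy⟩ := isPreconnected_univ.intermediate_value (mem_univ x) (mem_univ z)
    (continuous_infDist_pt S).continuousOn ⟨h0, hrz⟩
  exact ⟨y, hy⟩

variable {E : Type*} [NormedAddCommGroup E] [InnerProductSpace ℝ E] [FiniteDimensional ℝ E]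
  [MeasurableSpace E] [BorelSpace E] [Nontrivial E]

theorem volume_thickening_mul_le {a : ℝ} (ha : 0 < a) (r : ℝ) {T : Set E}
    (hT : IsCompact T) (hTc : IsConnected T) (hfin : μH[1] T ≠ ∞) :
    volume (thickening (a * r) T) ≤ ENNReal.ofReal (a ^ finrank ℝ E) * volume (ball (0 : E) r) +
      ENNReal.ofReal (a ^ (finrank ℝ E - 1)) * (luneRate E r * μH[1] T) := by
  refine (volume_thickening_le _ hT hTc hfin).trans ?_
  rw [Measure.addHaar_ball_mul_of_pos _ _ ha, ← mul_assoc]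
  gcongr
  exact luneRate_mul_le ha r

theorem hausdorffMeasure_le_of_thickening_subset {Γ T : Set E} {r : ℝ} (hr : 0 < r)
    (hΓ : volume (ball (0 : E) r) + luneRate E r * μH[1] Γ ≤ volume (thickening r Γ))
    (hrate : luneRate E r ≠ ∞) (hT : IsCompact T) (hTc : IsConnected T)
    (hsub : thickening r Γ ⊆ cthickening r T) : μH[1] Γ ≤ μH[1] T := by
  rcases eq_or_ne (μH[1] T) ∞ with hfin | hfin
  · rw [hfin]; exact le_top
  have hlim : Tendsto (fun a : ℝ => ENNReal.ofReal (a ^ finrank ℝ E) * volume (ball (0 : E) r) +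
      ENNReal.ofReal (a ^ (finrank ℝ E - 1)) * (luneRate E r * μH[1] T)) (𝓝[>] 1)
      (𝓝 (volume (ball (0 : E) r) + luneRate E r * μH[1] T)) := by
    have h1 (k : ℕ) : Tendsto (fun a : ℝ => ENNReal.ofReal (a ^ k)) (𝓝[>] 1) (𝓝 1) := by
      have : Continuous fun a : ℝ => ENNReal.ofReal (a ^ k) :=
        ENNReal.continuous_ofReal.comp (continuous_pow k)
      simpa using (this.tendsto 1).mono_left nhdsWithin_le_nhds
    simpa using (ENNReal.Tendsto.mul_const (h1 _) (Or.inl one_ne_zero)).add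
      (ENNReal.Tendsto.mul_const (h1 _) (Or.inl one_ne_zero))
  have hle : volume (ball (0 : E) r) + luneRate E r * μH[1] Γ ≤
      volume (ball (0 : E) r) + luneRate E r * μH[1] T := by
    refine ge_of_tendsto hlim ?_
    filter_upwards [self_mem_nhdsWithin] with a ha
    have ha0 : (0 : ℝ) < a := one_pos.trans ha
    refine hΓ.trans ((measure_mono (hsub.trans ?_)).trans
      (volume_thickening_mul_le ha0 r hT hTc hfin))
    -- The upper bound concerns open tubes, so the closed one is enlarged by a factor a > 1, and a
    -- tends to 1.
    exact cthickening_subset_thickening' (by positivity) (lt_mul_of_one_lt_left hr ha) T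
  rw [ENNReal.add_le_add_iff_left measure_ball_lt_top.ne] at hle
  exact (ENNReal.mul_le_mul_iff_right (luneRate_pos hr).ne' hrate).1 hle

theorem not_thickening_subset_cthickening {Γ T : Set E} {r s : ℝ} (hr : 0 < r)
    (hΓ : volume (ball (0 : E) r) + luneRate E r * μH[1] Γ ≤ volume (thickening r Γ))
    (hrate : luneRate E r ≠ ∞) (hfin : μH[1] Γ ≠ ∞) (hT : IsCompact T) (hTc : IsConnected T)
    (hle : μH[1] T ≤ μH[1] Γ) (hs : s < r) : ¬ thickening r Γ ⊆ cthickening s T := by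
  intro hsub
  obtain ⟨ρ, hρ, hρr⟩ := exists_between (max_lt hs hr)
  have hρ0 : 0 < ρ := (le_max_right _ _).trans_lt hρ
  have ha0 : 0 < ρ / r := by positivity
  have ha1 : ρ / r < 1 := (div_lt_one hr).2 hρr
  have hb0 : volume (ball (0 : E) r) ≠ 0 := (measure_ball_pos _ _ hr).ne'
  have h1 : volume (thickening r Γ) ≤ volume (thickening (ρ / r * r) T) := by
    rw [div_mul_cancel₀ _ hr.ne']
    exact measure_mono (hsub.trans
      (cthickening_subset_thickening' hρ0 ((le_max_left _ _).trans_lt hρ) T))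
  have h2 := volume_thickening_mul_le ha0 r hT hTc (ne_top_of_le_ne_top hfin hle)
  -- Strictness comes from the ball term alone; in dimension one the factor of the length term is 1.
  have h3 : ENNReal.ofReal ((ρ / r) ^ finrank ℝ E) * volume (ball (0 : E) r) <
      volume (ball (0 : E) r) := by
    nth_rewrite 2 [← one_mul (volume (ball (0 : E) r))]
    refine ENNReal.mul_lt_mul_left hb0 measure_ball_lt_top.ne ?_
    rw [ENNReal.ofReal_lt_one]
    exact pow_lt_one₀ ha0.le ha1 finrank_pos.ne'
  have h4 : ENNReal.ofReal ((ρ / r) ^ (finrank ℝ E - 1)) * (luneRate E r * μH[1] T) ≤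
      luneRate E r * μH[1] Γ := by
    calc _ ≤ 1 * (luneRate E r * μH[1] Γ) := by
          gcongr
          exact ENNReal.ofReal_le_one.2 (pow_le_one₀ ha0.le ha1.le)
      _ = _ := one_mul _
  have h5 := ENNReal.add_lt_add_of_lt_of_le
    (ne_top_of_le_ne_top (ENNReal.mul_ne_top hrate hfin) h4) h3 h4
  exact absurd (hΓ.trans (h1.trans h2)) (not_le.2 h5)

end Minimality

/-! ### From energies to tubes, and the theorem -/

theorem subset_cthickening_of_maxDistEnergy_le {d : ℕ} {M S : Set (EuclideanSpace ℝ (Fin d))}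
    {r : ℝ} (h : maxDistEnergy M S ≤ ENNReal.ofReal r) : M ⊆ Metric.cthickening r S :=
  fun y hy => Metric.mem_cthickening_iff.2 (iSup₂_le_iff.1 h y hy)

theorem maxDistEnergy_cthickening {d : ℕ} [Nontrivial (EuclideanSpace ℝ (Fin d))]
    {S : Set (EuclideanSpace ℝ (Fin d))} (hS : Bornology.IsBounded S) (hne : S.Nonempty) {r : ℝ}
    (hr : 0 ≤ r) : maxDistEnergy (Metric.cthickening r S) S = ENNReal.ofReal r := by
  refine le_antisymm (iSup₂_le fun y hy => Metric.mem_cthickening_iff.1 hy) ?_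
  obtain ⟨y, hy⟩ := exists_infDist_eq hS hne hr
  have h : Metric.infEDist y S = ENNReal.ofReal r := by
    rw [← hy, Metric.infDist, ENNReal.ofReal_toReal (Metric.infEDist_ne_top hne)]
  rw [← h]
  exact le_iSup₂_of_le y (Metric.mem_cthickening_iff.2 h.le) le_rfl

theorem IsSimpleC11Curve.exists_isRegularArc {d : ℕ} {Γ : Set (EuclideanSpace ℝ (Fin d))}
    (hΓ : IsSimpleC11Curve Γ) :
    ∃ γ g a b K m, IsRegularArc γ g a b K m ∧ Γ = γ '' Icc a b := by
  obtain ⟨a, b, γ, hab, hC, ⟨K, hK⟩, hne, hinj, rfl⟩ := hΓ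
  obtain ⟨t₀, ht₀, hmin⟩ := isCompact_Icc.exists_isMinOn (nonempty_Icc.2 hab.le)
    hK.continuousOn.norm
  -- K + 1 makes the Lipschitz constant positive; m is the minimum of the speed, attained by
  -- compactness.
  refine ⟨γ, derivWithin γ (Icc a b), a, b, K + 1, ‖derivWithin γ (Icc a b) t₀‖,
    ⟨fun t ht => ((hC.differentiableOn one_ne_zero) t ht).hasDerivWithinAt, fun s hs t ht => ?_,
      hinj, hab, by positivity, norm_pos_iff.2 (hne t₀ ht₀), fun t ht => hmin ht⟩, rfl⟩
  have h := hK.dist_le_mul s hs t ht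
  rw [dist_eq_norm, Real.dist_eq] at h
  exact h.trans (mul_le_mul_of_nonneg_right (le_add_of_nonneg_right zero_le_one) (abs_nonneg _))

theorem mainTheorem1 {d : ℕ} (Γ : Set (EuclideanSpace ℝ (Fin d))) (hΓ : IsSimpleC11Curve Γ) :
    ∃ l : ℝ, 0 < l ∧ μH[1] Γ = ENNReal.ofReal l ∧
      ∃ r₀ : ℝ, 0 < r₀ ∧ ∀ r : ℝ, 0 < r → r < r₀ →
        IsMaxDistMinimizer (Metric.cthickening r Γ) l Γ ∧
        maxDistEnergy (Metric.cthickening r Γ) Γ = ENNReal.ofReal r ∧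
        IsDualMaxDistMinimizer (Metric.cthickening r Γ) r Γ := by
  obtain ⟨γ, g, a, b, K, m, h, rfl⟩ := hΓ.exists_isRegularArc
  have ha : a ∈ Icc a b := left_mem_Icc.2 h.lt.le
  have hb : b ∈ Icc a b := right_mem_Icc.2 h.lt.le
  have hne : γ a ≠ γ b := fun heq => h.lt.ne (h.injOn ha hb heq)
  have : Nontrivial (EuclideanSpace ℝ (Fin d)) := ⟨_, _, hne⟩
  have hcomp : IsCompact (γ '' Icc a b) := isCompact_Icc.image_of_continuousOn h.continuousOn
  have hconn : IsConnected (γ '' Icc a b) := (isConnected_Icc h.lt.le).image γ h.continuousOn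
  have hpos : 0 < μH[1] (γ '' Icc a b) := (edist_pos.2 hne).trans_le
    (edist_le_hausdorffMeasure hconn.isPreconnected (mem_image_of_mem γ ha) (mem_image_of_mem γ hb))
  have hfin : μH[1] (γ '' Icc a b) ≠ ∞ := by
    obtain ⟨C, hC⟩ := h.exists_lipschitzOnWith
    refine ne_top_of_le_ne_top ?_ (hC.hausdorffMeasure_image_le zero_le_one)
    rw [hausdorffMeasure_real, Real.volume_Icc, ENNReal.rpow_one]
    exact ENNReal.mul_ne_top ENNReal.coe_ne_top ENNReal.ofReal_ne_top
  obtain ⟨r₀, hr₀, hvol⟩ := h.exists_le_volume_thickening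
  refine ⟨(μH[1] (γ '' Icc a b)).toReal, ENNReal.toReal_pos hpos.ne' hfin,
    (ENNReal.ofReal_toReal hfin).symm, r₀, hr₀, fun r hr hrr => ?_⟩
  have hV := hvol r hr hrr
  have henergy := maxDistEnergy_cthickening hcomp.isBounded hconn.nonempty hr.le
  -- The lower bound itself shows that the rate is finite: Γ has positive length and its bounded
  -- tube has finite volume.
  have hrate : luneRate (EuclideanSpace ℝ (Fin d)) r ≠ ∞ := by
    intro htop
    rw [htop, ENNReal.top_mul hpos.ne', add_top, top_le_iff] at hV
    exact hcomp.isBounded.thickening.measure_lt_top.ne hV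
  have hM : IsCompact (Metric.cthickening r (γ '' Icc a b)) := hcomp.cthickening
  have hsub := Metric.thickening_subset_cthickening r (γ '' Icc a b)
  refine ⟨⟨hM, hcomp, hconn, (ENNReal.ofReal_toReal hfin).ge, fun T hT hTc hle => ?_⟩, henergy,
    ⟨hM, hcomp, hconn, henergy.le, fun T hT hTc hle => ?_⟩⟩
  · rw [ENNReal.ofReal_toReal hfin] at hle
    rw [henergy]
    by_contra! hlt
    have hE : ENNReal.ofReal (maxDistEnergy (Metric.cthickening r (γ '' Icc a b)) T).toReal =
        maxDistEnergy (Metric.cthickening r (γ '' Icc a b)) T := ENNReal.ofReal_toReal hlt.ne_top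
    rw [← hE, ENNReal.ofReal_lt_ofReal_iff hr] at hlt
    exact not_thickening_subset_cthickening hr hV hrate hfin hT hTc hle hlt
      (hsub.trans (subset_cthickening_of_maxDistEnergy_le hE.ge))
  · exact hausdorffMeasure_le_of_thickening_subset hr hV hrate hT hTc
      (hsub.trans (subset_cthickening_of_maxDistEnergy_le hle))
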